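/- Let $\mathcal H=\ell^2(\mathbb N_0)$ be the single-mode Fock space with number states $|k\rangle$, and for $\alpha\in\mathbb C$ let $|\alpha\rangle=e^{-|\alpha|^2/2}\sum_{k\ge 0}\frac{\alpha^k}{\sqrt{k!}}|k\rangle$ be the coherent state. For a complex random variable $X$ let $\hat\rho_X=\mathbb E\big[|X\rangle\langle X|\big]$ be the corresponding mixture of coherent states (so $\hat\rho_X=\sum_x p_X(x)|x\rangle\langle x|$ if $X$ is discrete). Let $\bar m\ge 0$, let $X_G\sim\mathbb C\mathcal N(0,\bar m)$ (independent real and imaginary parts, each of law $\mathcal N(0,\bar m/2)$), and let $(X_n)_{n\in\mathbb N}$ be complex random variables that converge in distribution to $X_G$. Put $$|\Phi_{AB_n}\rangle=(\mathbb 1_A\otimes\hat\rho_{X_n}^{1/2})\sum_{k=0}^\infty|k\rangle|k\rangle=\sum_{k=0}^\infty|k\rangle\otimes\hat\rho_{X_n}^{1/2}|k\rangle\in\mathcal H_A\otimes\mathcal H_B,\qquad \hat\rho_{AB_n}=|\Phi_{AB_n}\rangle\langle\Phi_{AB_n}|,$$ and let $\hat\rho_{AB}=|\nu\rangle\langle\nu|$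 be the EPR (two-mode squeezed vacuum) state with $\nu=2\bar m+1$, where $$|\nu\rangle=\sqrt{\tfrac{2}{\nu+1}}\sum_{k=0}^\infty\Big(\tfrac{\nu-1}{\nu+1}\Big)^{k/2}|k\rangle|k\rangle .$$ Then the series $\sum_k|k\rangle\otimes\hat\rho_{X_n}^{1/2}|k\rangle$ converges in $\mathcal H_A\otimes\mathcal H_B$, and $|\Phi_{AB_n}\rangle$ is a purification of $\hat\rho_{X_n}$: it is a unit vector and $\operatorname{Tr}_A\hat\rho_{AB_n}=\hat\rho_{X_n}$. Moreover $\hat\rho_{AB_n}\to\hat\rho_{AB}$ weakly, that is, $\langle\psi|\hat\rho_{AB_n}|\gamma\rangle\to\langle\psi|\hat\rho_{AB}|\gamma\rangle$ for all $\psi,\gamma\in\mathcal H_A\otimes\mathcal H_B$, and in trace norm, $\|\hat\rho_{AB_n}-\hat\rho_{AB}\|_1\to 0$. -/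

import Mathlib

open MeasureTheory ProbabilityTheory Filter Topology
open scoped NNReal ENNReal TensorProduct InnerProductSpace

/-- The single-mode Fock space `ℓ²(ℕ, ℂ)`; the standard basis is the number-state basis. -/
abbrev Fock : Type := lp (fun _ : ℕ => ℂ) 2

/-- The Hilbert-space tensor product `H_A ⊗ H_B` of two modes: the completion of the algebraic
tensor product for the inner product `⟪a ⊗ b, a' ⊗ b'⟫ = ⟪a, a'⟫ ⟪b, b'⟫`. -/
abbrev TwoMode : Type := UniformSpace.Completion (Fock ⊗[ℂ] Fock)

/-- The number state `|k⟩`. -/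
noncomputable def ket (k : ℕ) : Fock := lp.single 2 k (1 : ℂ)

/-- The product vector `|u⟩|v⟩` in `H_A ⊗ H_B`. -/
noncomputable def tensorVec (u v : Fock) : TwoMode := ((u ⊗ₜ[ℂ] v : Fock ⊗[ℂ] Fock) : TwoMode)

/-- The operator `|ψ⟩⟨ψ|`. -/
noncomputable def proj {H : Type*} [NormedAddCommGroup H] [InnerProductSpace ℂ H] (ψ : H) :
    H →L[ℂ] H := InnerProductSpace.rankOne ℂ ψ ψ

theorem continuous_proj {H : Type*} [NormedAddCommGroup H] [InnerProductSpace ℂ H] :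
    Continuous (proj : H → H →L[ℂ] H) := by
  rw [continuous_iff_continuousAt]
  intro y
  have hb : ∀ x, proj x - proj y = InnerProductSpace.rankOne ℂ (x - y) x +
      InnerProductSpace.rankOne ℂ y (x - y) := fun x => by simp [proj]
  rw [ContinuousAt, tendsto_iff_norm_sub_tendsto_zero]
  have hc : Continuous fun x : H => ‖x - y‖ * ‖x‖ + ‖y‖ * ‖x - y‖ := by fun_prop
  have h := hc.tendsto y
  simp only [sub_self, norm_zero, zero_mul, mul_zero, add_zero] at h
  refine squeeze_zero (fun _ => norm_nonneg _) (fun x => ?_) h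
  rw [hb]
  refine (norm_add_le _ _).trans ?_
  rw [InnerProductSpace.norm_rankOne, InnerProductSpace.norm_rankOne]

/-- The positive square root `T^{1/2}` of a positive bounded operator. -/
noncomputable def opSqrt {H : Type*} [NormedAddCommGroup H] [InnerProductSpace ℂ H]
    [CompleteSpace H] (T : H →L[ℂ] H) : H →L[ℂ] H := CFC.sqrt T

/-- The number-state amplitudes `e^{-|α|²/2} αⁿ / √(n!)` of a coherent state. -/
noncomputable def coherentCoeff (α : ℂ) (n : ℕ) : ℂ :=
  (Real.exp (-‖α‖ ^ 2 / 2) : ℂ) * (α ^ n / (Real.sqrt (n.factorial : ℝ) : ℂ))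

theorem coherentCoeff_memℓp (α : ℂ) : Memℓp (coherentCoeff α) 2 := by
  apply memℓp_gen
  have h : ∀ n, ‖coherentCoeff α n‖ ^ (2 : ℝ≥0∞).toReal =
      (Real.exp (-‖α‖ ^ 2 / 2)) ^ 2 * ((‖α‖ ^ 2) ^ n / n.factorial) := by
    intro n
    have h2 : (2 : ℝ≥0∞).toReal = ((2 : ℕ) : ℝ) := by simp
    rw [h2, Real.rpow_natCast, coherentCoeff, norm_mul, norm_div, norm_pow, Complex.norm_real,
      Complex.norm_real, mul_pow, div_pow, Real.norm_of_nonneg (Real.exp_pos _).le,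
      Real.norm_of_nonneg (Real.sqrt_nonneg _), Real.sq_sqrt (by positivity)]
    ring
  simp_rw [h]
  exact (Real.summable_pow_div_factorial _).mul_left _

/-- The coherent state `|α⟩ = e^{-|α|²/2} ∑ₙ αⁿ/√(n!) |n⟩`. -/
noncomputable def coherent (α : ℂ) : Fock := ⟨coherentCoeff α, coherentCoeff_memℓp α⟩

theorem inner_coherent (α β : ℂ) :
    ⟪coherent α, coherent β⟫_ℂ =
      (Real.exp (-‖α‖ ^ 2 / 2) : ℂ) * (Real.exp (-‖β‖ ^ 2 / 2) : ℂ) *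
        Complex.exp ((starRingEnd ℂ) α * β) := by
  have h1 := lp.hasSum_inner (𝕜 := ℂ) (coherent α) (coherent β)
  have h2 : HasSum (fun n : ℕ => ((starRingEnd ℂ) α * β) ^ n / (n.factorial : ℂ))
      (Complex.exp ((starRingEnd ℂ) α * β)) := by
    rw [Complex.exp_eq_exp_ℂ]
    exact NormedSpace.expSeries_div_hasSum_exp _
  have h3 := h2.mul_left ((Real.exp (-‖α‖ ^ 2 / 2) : ℂ) * (Real.exp (-‖β‖ ^ 2 / 2) : ℂ))
  refine h1.unique (h3.congr_fun ?_)
  intro n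
  have hs : ((Real.sqrt (n.factorial : ℝ) : ℂ)) * (Real.sqrt (n.factorial : ℝ) : ℂ)
      = (n.factorial : ℂ) := by
    rw [← Complex.ofReal_mul, Real.mul_self_sqrt (by positivity)]
    simp
  change ⟪coherentCoeff α n, coherentCoeff β n⟫_ℂ = _
  rw [RCLike.inner_apply, coherentCoeff, coherentCoeff, ← hs]
  simp only [map_mul, map_div₀, map_pow, Complex.conj_ofReal]
  rw [mul_pow]
  ring

theorem norm_coherent (α : ℂ) : ‖coherent α‖ = 1 := by
  have h : ‖coherent α‖ ^ 2 = 1 := by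
    have h := inner_self_eq_norm_sq_to_K (𝕜 := ℂ) (coherent α)
    rw [inner_coherent, Complex.conj_mul', ← Complex.ofReal_pow, ← Complex.ofReal_exp,
      ← Complex.ofReal_mul, ← Complex.ofReal_mul, ← Real.exp_add, ← Real.exp_add] at h
    have : -‖α‖ ^ 2 / 2 + -‖α‖ ^ 2 / 2 + ‖α‖ ^ 2 = 0 := by ring
    rw [this, Real.exp_zero] at h
    exact Complex.ofReal_injective (by simpa using h.symm)
  nlinarith [norm_nonneg (coherent α)]

theorem continuous_coherent : Continuous coherent := by
  rw [continuous_iff_continuousAt]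
  intro β
  rw [ContinuousAt, tendsto_iff_norm_sub_tendsto_zero]
  have h : ∀ α, ‖coherent α - coherent β‖ =
      Real.sqrt (2 - 2 * (⟪coherent α, coherent β⟫_ℂ).re) := by
    intro α
    have := norm_sub_sq (𝕜 := ℂ) (coherent α) (coherent β)
    rw [norm_coherent, norm_coherent] at this
    rw [← Real.sqrt_sq (norm_nonneg (coherent α - coherent β)), this]
    congr 1
    simp only [RCLike.re_to_complex]
    ring
  simp_rw [h]
  have hc : Continuous fun α : ℂ => Real.sqrt (2 - 2 * (⟪coherent α, coherent β⟫_ℂ).re) := by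
    simp_rw [inner_coherent]
    fun_prop
  have := hc.tendsto β
  rwa [← h, sub_self, norm_zero] at this

/-- The mixture of coherent states is a genuine (norm-convergent) Bochner integral. -/
theorem integrable_proj_coherent (μ : Measure ℂ) [IsFiniteMeasure μ] :
    Integrable (fun α => proj (coherent α)) μ := by
  have hc : Continuous fun α : ℂ => proj (coherent α) := continuous_proj.comp continuous_coherent
  refine Integrable.of_bound hc.aestronglyMeasurable 1 (ae_of_all _ fun α => ?_)
  simp [proj, norm_coherent]

/-- The density operator `ρ_X = 𝔼 |X⟩⟨X| = ∫ |α⟩⟨α| dμ(α)` of a modulation `X` of law `μ`; for a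
constellation with masses `p(x)` it is `∑ₓ p(x) |x⟩⟨x|`. -/
noncomputable def mixture (μ : Measure ℂ) : Fock →L[ℂ] Fock := ∫ α, proj (coherent α) ∂μ

/-- The `k`-th term `(1 ⊗ ρ^{1/2}) |k⟩|k⟩ = |k⟩ ⊗ ρ^{1/2}|k⟩`. -/
noncomputable def purificationTerm (ρ : Fock →L[ℂ] Fock) (k : ℕ) : TwoMode :=
  tensorVec (ket k) (opSqrt ρ (ket k))

/-- The vector `|Φ_{AB}⟩ = (1 ⊗ ρ^{1/2}) ∑ₖ |k⟩|k⟩`, read as `∑ₖ |k⟩ ⊗ ρ^{1/2}|k⟩`. -/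
noncomputable def purification (ρ : Fock →L[ℂ] Fock) : TwoMode := ∑' k, purificationTerm ρ k

/-- `Φ` is a purification of `ρ`: a unit vector of `H_A ⊗ H_B` such that the partial trace over `A`
of `|Φ⟩⟨Φ|` is `ρ`, i.e. `∑ₖ (⟨k| ⊗ ⟨u|) |Φ⟩⟨Φ| (|k⟩ ⊗ |v⟩) = ⟨u| ρ |v⟩`. -/
def IsPurification (Φ : TwoMode) (ρ : Fock →L[ℂ] Fock) : Prop :=
  ‖Φ‖ = 1 ∧ ∀ u v : Fock,
    HasSum (fun k => ⟪tensorVec (ket k) u, proj Φ (tensorVec (ket k) v)⟫_ℂ) ⟪u, ρ v⟫_ℂ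

/-- The number-state amplitudes `√(2/(ν+1)) (√((ν-1)/(ν+1)))ⁿ` of the EPR state. -/
noncomputable def eprCoeff (ν : ℝ) (n : ℕ) : ℝ :=
  Real.sqrt (2 / (ν + 1)) * Real.sqrt ((ν - 1) / (ν + 1)) ^ n

/-- The EPR (two-mode squeezed vacuum) state `|ν⟩ = √(2/(ν+1)) ∑ₙ ((ν-1)/(ν+1))^{n/2} |n⟩|n⟩`,
for `ν ≥ 1`. -/
noncomputable def epr (ν : ℝ) : TwoMode := ∑' n, (eprCoeff ν n : ℂ) • tensorVec (ket n) (ket n)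

theorem norm_tensorVec (u v : Fock) : ‖tensorVec u v‖ = ‖u‖ * ‖v‖ := by
  rw [tensorVec, UniformSpace.Completion.norm_coe, TensorProduct.norm_tmul]

/-- The series that defines the EPR state converges. -/
theorem summable_epr {ν : ℝ} (hν : 1 ≤ ν) :
    Summable fun n => (eprCoeff ν n : ℂ) • tensorVec (ket n) (ket n) := by
  have hk : ∀ n, ‖ket n‖ = 1 := fun n => by
    rw [ket, lp.norm_single (by norm_num), norm_one]
  refine Summable.of_norm ?_
  have h : ∀ n, ‖(eprCoeff ν n : ℂ) • tensorVec (ket n) (ket n)‖ = eprCoeff ν n := fun n => by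
    rw [norm_smul, norm_tensorVec, hk, Complex.norm_real, eprCoeff, Real.norm_of_nonneg (by positivity)]
    ring
  simp_rw [h, eprCoeff]
  refine (summable_geometric_of_lt_one (Real.sqrt_nonneg _) ?_).mul_left _
  rw [Real.sqrt_lt' one_pos, one_pow, div_lt_one (by linarith)]
  linarith

/-- The trace norm `‖T‖₁ = Tr |T|`, where `|T| = (T* T)^{1/2}` and the trace of the positive
operator `|T|` is the supremum of `∑_{e ∈ s} ⟨e| |T| |e⟩` over the finite orthonormal sets `s`. -/
noncomputable def traceNorm {H : Type*} [NormedAddCommGroup H] [InnerProductSpace ℂ H]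
    [CompleteSpace H] (T : H →L[ℂ] H) : ℝ≥0∞ :=
  ⨆ (s : Finset H) (_ : Orthonormal ℂ ((↑) : s → H)),
    ENNReal.ofReal (∑ e ∈ s, (⟪e, CFC.abs T e⟫_ℂ).re)

/-- The law `CN(0, m)`: real and imaginary parts are independent `N(0, m/2)`, so `𝔼|X|² = m`. -/
noncomputable def complexGaussian (m : ℝ≥0) : Measure ℂ :=
  ((gaussianReal 0 (m / 2)).prod (gaussianReal 0 (m / 2))).map
    fun p : ℝ × ℝ => (p.1 : ℂ) + (p.2 : ℂ) * Complex.I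

/-!
The purification of `ρ` is a unit vector as soon as `∑ₖ ‖ρ^{1/2}|k⟩‖² = Tr ρ = 1`: its terms
`|k⟩ ⊗ ρ^{1/2}|k⟩` lie in mutually orthogonal sectors of the two-mode space, and the partial trace
over the first mode turns them into `⟪ρ^{1/2} u, ρ^{1/2} v⟫ = ⟪u, ρ v⟫`. For a mixture of coherent
states, `Tr ρ = 1` because coherent states are unit vectors.

For the limit it is enough to show `⟪Φₙ, epr⟫ → 1`. Two unit vectors whose inner product tends
to `1` approach each other in norm, which gives the weak convergence; and
`traceNorm_proj_sub_proj_le` bounds `‖|a⟩⟨a| - |b⟩⟨b|‖₁` by `2 √(1 - |⟪a, b⟫|²)` for unit vectors,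
which gives the convergence in trace norm.

The overlap is `∑ₖ sₖ ⟪ρₙ^{1/2}|k⟩, |k⟩⟫`, where `sₖ` are the amplitudes of the EPR state. These are
summable, so by dominated convergence the limit may be taken termwise, and the square roots are
controlled as follows.
* Matrix elements of the mixture are integrals of bounded continuous functions, so convergence in
  distribution gives `⟪u, ρₙ v⟫ → ⟪u, ρ v⟫` (`tendsto_inner_mixture`), where `ρ` is the Gaussian
  mixture. By rotation invariance and a radial Gamma integral, `ρ` is diagonal in the number basis,
  with eigenvalues `sₖ² = mᵏ / (m + 1)ᵏ⁺¹`.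
* No mass escapes to high number states, since `∑ⱼ ⟪j, ρₙ j⟫ = 1 = ∑ⱼ ⟪j, ρ j⟫`, and these diagonal
  elements dominate `|⟪j, ρₙ k⟫|²`. Hence `ρₙ|k⟩ → sₖ²|k⟩` in norm (`tendsto_mixture_ket`).
* For `T ≥ 0` and `s ≥ 0`, the factorization `T - s² = (T^{1/2} + s)(T^{1/2} - s)` and
  `T^{1/2} + s ≥ s` give `s ‖(T^{1/2} - s) x‖ ≤ ‖(T - s²) x‖` (`norm_opSqrt_sub_smul_le`). Hence
  `sₖ ρₙ^{1/2}|k⟩ → sₖ²|k⟩`, without appeal to any continuity of the operator square root.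
-/

/-! ### The trace distance of two pure states -/

section TraceNorm

variable {H : Type*} [NormedAddCommGroup H] [InnerProductSpace ℂ H]

theorem inner_proj (x y ψ : H) : ⟪x, proj ψ y⟫_ℂ = ⟪ψ, y⟫_ℂ * ⟪x, ψ⟫_ℂ := by
  simp [proj]

theorem inner_proj_self (x ψ : H) : ⟪x, proj ψ x⟫_ℂ = ((‖⟪x, ψ⟫_ℂ‖ ^ 2 : ℝ) : ℂ) := by
  rw [inner_proj, ← inner_conj_symm, Complex.conj_mul']
  push_cast
  rfl

theorem isPositive_proj (ψ : H) : (proj ψ).IsPositive := by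
  rw [ContinuousLinearMap.isPositive_iff_complex]
  intro x
  have h : ⟪proj ψ x, x⟫_ℂ = ((‖⟪x, ψ⟫_ℂ‖ ^ 2 : ℝ) : ℂ) := by
    rw [← inner_conj_symm, inner_proj_self, Complex.conj_ofReal]
  rw [h]
  exact ⟨by rw [RCLike.re_to_complex, Complex.ofReal_re],
    by simp only [RCLike.re_to_complex, Complex.ofReal_re]; positivity⟩

theorem inner_smul_proj_self (r : ℝ) (x ψ : H) :
    (⟪x, ((r : ℂ) • proj ψ) x⟫_ℂ).re = r * ‖⟪x, ψ⟫_ℂ‖ ^ 2 := by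
  rw [smul_apply, inner_smul_right, inner_proj_self, ← Complex.ofReal_mul,
    Complex.ofReal_re]

variable [CompleteSpace H]

/-- Bessel's inequality bounds the trace of each rank-one summand of `|T|`. -/
theorem traceNorm_le_of_abs_eq {T : H →L[ℂ] H} {a b : H} {r t : ℝ} (hr : 0 ≤ r) (ht : 0 ≤ t)
    (h : CFC.abs T = (r : ℂ) • proj a + (t : ℂ) • proj b) :
    traceNorm T ≤ ENNReal.ofReal (r * ‖a‖ ^ 2 + t * ‖b‖ ^ 2) := by
  refine iSup₂_le fun s hs => ENNReal.ofReal_le_ofReal ?_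
  have bessel : ∀ x : H, ∑ e ∈ s, ‖⟪e, x⟫_ℂ‖ ^ 2 ≤ ‖x‖ ^ 2 := fun x => by
    rw [← Finset.sum_attach]
    exact hs.sum_inner_products_le x
  have hterm : ∀ e : H, (⟪e, CFC.abs T e⟫_ℂ).re =
      r * ‖⟪e, a⟫_ℂ‖ ^ 2 + t * ‖⟪e, b⟫_ℂ‖ ^ 2 := fun e => by
    rw [h, add_apply, inner_add_right, Complex.add_re, inner_smul_proj_self,
      inner_smul_proj_self]
  simp_rw [hterm]
  rw [Finset.sum_add_distrib, ← Finset.mul_sum, ← Finset.mul_sum]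
  gcongr <;> exact bessel _

/-- For unit vectors, the square of `|a⟩⟨a| - |b⟩⟨b|` is already diagonal in the orthogonal pair
formed by `a` and the component of `b` orthogonal to `a`. -/
theorem star_proj_sub_proj_mul_self {a b : H} (ha : ‖a‖ = 1) (hb : ‖b‖ = 1) :
    star (proj a - proj b) * (proj a - proj b) =
      ((1 - ‖⟪a, b⟫_ℂ‖ ^ 2 : ℝ) : ℂ) • proj a + proj (b - ⟪a, b⟫_ℂ • a) := by
  have hsa : star (proj a - proj b) = proj a - proj b :=
    ((isPositive_proj a).isSelfAdjoint.sub (isPositive_proj b).isSelfAdjoint).star_eq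
  rw [hsa]
  ext x
  have haa : ⟪a, a⟫_ℂ = 1 := by simp [inner_self_eq_norm_sq_to_K, ha]
  have hbb : ⟪b, b⟫_ℂ = 1 := by simp [inner_self_eq_norm_sq_to_K, hb]
  have hn : ((‖⟪a, b⟫_ℂ‖ : ℝ) : ℂ) ^ 2 = ⟪a, b⟫_ℂ * ⟪b, a⟫_ℂ := by
    rw [← inner_conj_symm b a, Complex.mul_conj']
  simp only [proj, ContinuousLinearMap.mul_def, ContinuousLinearMap.comp_apply, sub_apply,
    add_apply, smul_apply, InnerProductSpace.rankOne_apply, inner_sub_right, inner_sub_left,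
    inner_smul_right, inner_smul_left, inner_conj_symm, haa, hbb]
  push_cast
  rw [hn]
  module

omit [CompleteSpace H] in
theorem norm_sub_inner_smul_sq {a b : H} (ha : ‖a‖ = 1) (hb : ‖b‖ = 1) :
    ‖b - ⟪a, b⟫_ℂ • a‖ ^ 2 = 1 - ‖⟪a, b⟫_ℂ‖ ^ 2 := by
  rw [norm_sub_sq (𝕜 := ℂ), hb, norm_smul, ha, inner_smul_right, ← inner_conj_symm b a,
    Complex.mul_conj', ← Complex.ofReal_pow, RCLike.re_to_complex, Complex.ofReal_re]
  ring

/-- The trace distance of two pure states in terms of their overlap (the bound is in fact an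
equality). With `l = √(1 - |⟪a, b⟫|²)` and `b'` the component of `b` orthogonal to `a`, so that
`‖b'‖ = l`, the absolute value of the difference is `l |a⟩⟨a| + l⁻¹ |b'⟩⟨b'|`. -/
theorem traceNorm_proj_sub_proj_le {a b : H} (ha : ‖a‖ = 1) (hb : ‖b‖ = 1) :
    traceNorm (proj a - proj b) ≤ ENNReal.ofReal (2 * Real.sqrt (1 - ‖⟪a, b⟫_ℂ‖ ^ 2)) := by
  set c := ⟪a, b⟫_ℂ with hc
  set b' := b - c • a with hb'
  set l := Real.sqrt (1 - ‖c‖ ^ 2) with hl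
  have hn : ‖b'‖ ^ 2 = 1 - ‖c‖ ^ 2 := norm_sub_inner_smul_sq ha hb
  have hl0 : 0 ≤ l := Real.sqrt_nonneg _
  have hl2 : l ^ 2 = 1 - ‖c‖ ^ 2 := Real.sq_sqrt (hn ▸ sq_nonneg _)
  have hT := star_proj_sub_proj_mul_self ha hb
  rw [← hc, ← hb', ← hl2] at hT
  rw [← hl2] at hn
  have haa : ⟪a, a⟫_ℂ = 1 := by simp [inner_self_eq_norm_sq_to_K, ha]
  have hab : ⟪a, b'⟫_ℂ = 0 := by
    rw [hb', inner_sub_right, inner_smul_right, haa, ← hc, mul_one, sub_self]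
  have hba : ⟪b', a⟫_ℂ = 0 := by rw [← inner_conj_symm, hab, map_zero]
  have hbb : ⟪b', b'⟫_ℂ = ((l ^ 2 : ℝ) : ℂ) := by
    rw [inner_self_eq_norm_sq_to_K, ← hn]
    norm_cast
  have habs : CFC.abs (proj a - proj b) = (l : ℂ) • proj a + ((l⁻¹ : ℝ) : ℂ) • proj b' := by
    rw [CFC.abs, hT]
    refine CFC.sqrt_unique ?_ ?_
    · ext x
      simp only [proj, ContinuousLinearMap.mul_def, ContinuousLinearMap.comp_apply,
        add_apply, smul_apply, InnerProductSpace.rankOne_apply, inner_add_right,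
        inner_smul_right, haa, hab, hba, hbb]
      -- If `l = 0` then `l⁻¹ = 0` as well, and `b' = 0` makes the formula correct.
      rcases eq_or_ne l 0 with h0 | h0
      · have : b' = 0 := by simpa [h0] using hn
        simp [h0, this]
      · have h0' : (l : ℂ) ≠ 0 := by exact_mod_cast h0
        push_cast
        match_scalars <;> field_simp <;> ring
    · rw [ContinuousLinearMap.nonneg_iff_isPositive]
      exact ((isPositive_proj a).smul_of_nonneg (by exact_mod_cast hl0)).add
        ((isPositive_proj b').smul_of_nonneg (by exact_mod_cast inv_nonneg.2 hl0))
  refine (traceNorm_le_of_abs_eq hl0 (inv_nonneg.2 hl0) habs).trans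
    (ENNReal.ofReal_le_ofReal (le_of_eq ?_))
  rw [ha, hn]
  rcases eq_or_ne l 0 with h0 | h0
  · simp [h0]
  · field_simp
    norm_num

end TraceNorm

/-! ### Square roots of positive operators -/

section OperatorSqrt

variable {H : Type*} [NormedAddCommGroup H] [InnerProductSpace ℂ H] [CompleteSpace H]

theorem opSqrt_isPositive (T : H →L[ℂ] H) : (opSqrt T).IsPositive :=
  (ContinuousLinearMap.nonneg_iff_isPositive _).1 (CFC.sqrt_nonneg T)

theorem inner_opSqrt_left (T : H →L[ℂ] H) (x y : H) :
    ⟪opSqrt T x, y⟫_ℂ = ⟪x, opSqrt T y⟫_ℂ :=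
  (opSqrt_isPositive T).inner_left_eq_inner_right x y

theorem opSqrt_opSqrt_apply {T : H →L[ℂ] H} (hT : 0 ≤ T) (x : H) :
    opSqrt T (opSqrt T x) = T x :=
  congrArg (fun A : H →L[ℂ] H => A x) (CFC.sqrt_mul_sqrt_self T hT)

theorem inner_opSqrt_opSqrt {T : H →L[ℂ] H} (hT : 0 ≤ T) (x y : H) :
    ⟪opSqrt T x, opSqrt T y⟫_ℂ = ⟪x, T y⟫_ℂ := by
  rw [inner_opSqrt_left, opSqrt_opSqrt_apply hT]

/-- A pointwise continuity estimate for the square root at an approximate eigenvector: it follows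
from `T - s² = (T^{1/2} + s)(T^{1/2} - s)` and `T^{1/2} + s ≥ s`. -/
theorem norm_opSqrt_sub_smul_le {T : H →L[ℂ] H} (hT : 0 ≤ T) {s : ℝ} (hs : 0 ≤ s) (x : H) :
    s * ‖opSqrt T x - (s : ℂ) • x‖ ≤ ‖T x - ((s ^ 2 : ℝ) : ℂ) • x‖ := by
  set S := opSqrt T with hS
  set w := S x - (s : ℂ) • x with hw
  have hfac : T x - ((s ^ 2 : ℝ) : ℂ) • x = S w + (s : ℂ) • w := by
    rw [hw, map_sub, map_smul, hS, opSqrt_opSqrt_apply hT]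
    push_cast
    module
  have hpos : 0 ≤ (⟪w, S w⟫_ℂ).re := (opSqrt_isPositive T).re_inner_nonneg_right w
  have hsq : (s * ‖w‖) ^ 2 ≤ ‖S w + (s : ℂ) • w‖ ^ 2 := by
    rw [norm_add_sq (𝕜 := ℂ), norm_smul, inner_smul_right, ← inner_conj_symm,
      RCLike.re_to_complex, Complex.re_ofReal_mul, Complex.conj_re, Complex.norm_real,
      Real.norm_of_nonneg hs]
    have := mul_nonneg hs hpos
    nlinarith [sq_nonneg ‖S w‖]
  rw [hfac]
  exact (sq_le_sq₀ (by positivity) (norm_nonneg _)).1 hsq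

end OperatorSqrt

/-! ### Unit vectors with overlap tending to one -/

theorem tendsto_of_tendsto_inner_of_norm_eq_one {H ι : Type*} [NormedAddCommGroup H]
    [InnerProductSpace ℂ H] {l : Filter ι} {x : ι → H} {y : H} (hx : ∀ i, ‖x i‖ = 1)
    (hy : ‖y‖ = 1) (h : Tendsto (fun i => ⟪x i, y⟫_ℂ) l (𝓝 1)) : Tendsto x l (𝓝 y) := by
  rw [tendsto_iff_norm_sub_tendsto_zero]
  have hsq : ∀ i, ‖x i - y‖ = Real.sqrt (2 - 2 * (⟪x i, y⟫_ℂ).re) := fun i => by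
    rw [← Real.sqrt_sq (norm_nonneg (x i - y)), norm_sub_sq (𝕜 := ℂ), hx, hy,
      RCLike.re_to_complex]
    congr 1
    ring
  simp_rw [hsq]
  have hlim := ((((Complex.continuous_re.tendsto _).comp h).const_mul 2).const_sub 2).sqrt
  rwa [Complex.one_re, mul_one, sub_self, Real.sqrt_zero] at hlim

/-! ### Number states and the two-mode space -/

theorem inner_ket_left (k : ℕ) (v : Fock) : ⟪ket k, v⟫_ℂ = v k := by
  rw [ket, lp.inner_single_left]
  simp

theorem norm_ket (k : ℕ) : ‖ket k‖ = 1 := by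
  rw [ket, lp.norm_single (by norm_num), norm_one]

theorem inner_ket_ket (j k : ℕ) : ⟪ket j, ket k⟫_ℂ = if j = k then 1 else 0 := by
  rw [inner_ket_left, ket, lp.single_apply, Pi.single_apply]

theorem inner_tensorVec (u v u' v' : Fock) :
    ⟪tensorVec u v, tensorVec u' v'⟫_ℂ = ⟪u, u'⟫_ℂ * ⟪v, v'⟫_ℂ := by
  rw [tensorVec, tensorVec, UniformSpace.Completion.inner_coe, TensorProduct.inner_tmul]

theorem hasSum_norm_apply_sq (v : Fock) : HasSum (fun k => ‖v k‖ ^ 2) (‖v‖ ^ 2) := by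
  simpa using lp.hasSum_norm (p := 2) (by norm_num) v

/-- The isometry `v ↦ |k⟩|v⟩` onto the `k`-th sector of the two-mode space. -/
noncomputable def ketTensor (k : ℕ) : Fock →ₗᵢ[ℂ] TwoMode where
  toFun v := tensorVec (ket k) v
  map_add' u v := by
    simp only [tensorVec, TensorProduct.tmul_add, UniformSpace.Completion.coe_add]
  map_smul' c v := by
    simp only [tensorVec, TensorProduct.tmul_smul, UniformSpace.Completion.coe_smul,
      RingHom.id_apply]
  norm_map' v := by
    change ‖tensorVec (ket k) v‖ = ‖v‖
    rw [norm_tensorVec, norm_ket, one_mul]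

theorem orthogonalFamily_ketTensor : OrthogonalFamily ℂ (fun _ : ℕ => Fock) ketTensor := by
  intro j k hjk u v
  change ⟪tensorVec (ket j) u, tensorVec (ket k) v⟫_ℂ = 0
  rw [inner_tensorVec, inner_ket_ket, if_neg hjk, zero_mul]

section Purification

variable {ρ : Fock →L[ℂ] Fock}

theorem summable_purificationTerm (h : HasSum (fun k => ‖opSqrt ρ (ket k)‖ ^ 2) 1) :
    Summable (purificationTerm ρ) :=
  (orthogonalFamily_ketTensor.summable_iff_norm_sq_summable
    fun k => opSqrt ρ (ket k)).2 h.summable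

theorem inner_tensorVec_ket_purification (h : HasSum (fun k => ‖opSqrt ρ (ket k)‖ ^ 2) 1)
    (k : ℕ) (u : Fock) :
    ⟪tensorVec (ket k) u, purification ρ⟫_ℂ = ⟪u, opSqrt ρ (ket k)⟫_ℂ := by
  have hs := (summable_purificationTerm h).hasSum.mapL (innerSL ℂ (tensorVec (ket k) u))
  simp only [innerSL_apply_apply, purificationTerm, inner_tensorVec, inner_ket_ket] at hs
  refine hs.unique ?_
  refine (hasSum_ite_eq k ⟪u, opSqrt ρ (ket k)⟫_ℂ).congr_fun fun j => ?_
  rcases eq_or_ne j k with rfl | hj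
  · simp
  · simp [hj, hj.symm]

theorem norm_purification (h : HasSum (fun k => ‖opSqrt ρ (ket k)‖ ^ 2) 1) :
    ‖purification ρ‖ = 1 := by
  have hs := (summable_purificationTerm h).hasSum.mapL (innerSL ℂ (purification ρ))
  have hterm : ∀ k, innerSL ℂ (purification ρ) (purificationTerm ρ k) =
      ((‖opSqrt ρ (ket k)‖ ^ 2 : ℝ) : ℂ) := fun k => by
    rw [innerSL_apply_apply, ← inner_conj_symm, purificationTerm,
      inner_tensorVec_ket_purification h, inner_self_eq_norm_sq_to_K]
    simp
  simp_rw [hterm] at hs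
  have h1 := hs.unique (Complex.hasSum_ofReal.2 h)
  change ⟪purification ρ, purification ρ⟫_ℂ = _ at h1
  rw [inner_self_eq_norm_sq_to_K] at h1
  have h2 : ‖purification ρ‖ ^ 2 = 1 := Complex.ofReal_injective (by simpa using h1)
  exact (pow_eq_one_iff_of_nonneg (norm_nonneg _) two_ne_zero).1 h2

theorem isPurification_purification (hρ : 0 ≤ ρ)
    (h : HasSum (fun k => ‖opSqrt ρ (ket k)‖ ^ 2) 1) :
    IsPurification (purification ρ) ρ := by
  refine ⟨norm_purification h, fun u v => ?_⟩
  have hs := lp.hasSum_inner (𝕜 := ℂ) (opSqrt ρ u) (opSqrt ρ v)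
  rw [inner_opSqrt_opSqrt hρ] at hs
  refine hs.congr_fun fun k => ?_
  rw [inner_proj, inner_tensorVec_ket_purification h, ← inner_conj_symm,
    inner_tensorVec_ket_purification h, inner_conj_symm, inner_opSqrt_left,
    ← inner_opSqrt_left ρ u, inner_ket_left, ← inner_conj_symm (opSqrt ρ u), inner_ket_left]
  rfl

end Purification

/-! ### Mixtures of coherent states -/

theorem inner_mixture (μ : Measure ℂ) [IsFiniteMeasure μ] (u v : Fock) :
    ⟪u, mixture μ v⟫_ℂ = ∫ α, ⟪coherent α, v⟫_ℂ * ⟪u, coherent α⟫_ℂ ∂μ := by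
  have hint := integrable_proj_coherent μ
  rw [mixture, ContinuousLinearMap.integral_apply hint,
    ← integral_inner (hint.apply_continuousLinearMap v)]
  simp_rw [inner_proj]

theorem mixture_nonneg (μ : Measure ℂ) [IsFiniteMeasure μ] : 0 ≤ mixture μ := by
  rw [ContinuousLinearMap.nonneg_iff_isPositive, ContinuousLinearMap.isPositive_iff_complex]
  intro u
  have h : ⟪mixture μ u, u⟫_ℂ = ((∫ α, ‖⟪u, coherent α⟫_ℂ‖ ^ 2 ∂μ : ℝ) : ℂ) := by
    rw [← inner_conj_symm, inner_mixture, ← integral_complex_ofReal, ← integral_conj]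
    congr 1
    funext α
    rw [← inner_conj_symm (coherent α) u, Complex.conj_mul', map_pow, Complex.conj_ofReal]
    push_cast
    rfl
  rw [h]
  refine ⟨by rw [RCLike.re_to_complex, Complex.ofReal_re], ?_⟩
  rw [RCLike.re_to_complex, Complex.ofReal_re]
  positivity

theorem inner_ket_mixture_ket (μ : Measure ℂ) [IsFiniteMeasure μ] (j k : ℕ) :
    ⟪ket j, mixture μ (ket k)⟫_ℂ =
      ∫ α, starRingEnd ℂ (coherentCoeff α k) * coherentCoeff α j ∂μ := by
  rw [inner_mixture]
  congr 1
  funext α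
  rw [← inner_conj_symm (coherent α), inner_ket_left, inner_ket_left]
  rfl

/-- The mixture has trace one: `∑ₖ ‖ρ^{1/2}|k⟩‖² = ∑ₖ ∫ |⟨k|α⟩|² dμ(α) = 1`, because coherent
states are unit vectors. -/
theorem hasSum_norm_opSqrt_mixture_sq (μ : Measure ℂ) [IsProbabilityMeasure μ] :
    HasSum (fun k => ‖opSqrt (mixture μ) (ket k)‖ ^ 2) 1 := by
  have hterm : ∀ k, ‖opSqrt (mixture μ) (ket k)‖ ^ 2 = ∫ α, ‖coherent α k‖ ^ 2 ∂μ := fun k => by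
    have h : ((‖opSqrt (mixture μ) (ket k)‖ ^ 2 : ℝ) : ℂ) =
        ((∫ α, ‖coherent α k‖ ^ 2 ∂μ : ℝ) : ℂ) := by
      rw [← integral_complex_ofReal]
      push_cast
      rw [← Complex.coe_algebraMap, ← inner_self_eq_norm_sq_to_K (𝕜 := ℂ),
        inner_opSqrt_opSqrt (mixture_nonneg μ), inner_ket_mixture_ket]
      congr 1
      funext α
      exact Complex.conj_mul' _
    exact_mod_cast h
  simp_rw [hterm]
  have hsum : ∀ α, HasSum (fun k => ‖coherent α k‖ ^ 2) 1 := fun α => by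
    simpa [norm_coherent] using hasSum_norm_apply_sq (coherent α)
  have h := hasSum_integral_of_dominated_convergence (μ := μ)
    (F := fun k α => ‖coherent α k‖ ^ 2) (f := fun _ => (1 : ℝ))
    (fun k α => ‖coherent α k‖ ^ 2) (fun k => ?_) (fun k => ae_of_all _ fun α => by simp)
    (ae_of_all _ fun α => (hsum α).summable) (by simp [(hsum _).tsum_eq])
    (ae_of_all _ hsum)
  · simpa using h
  · have : Continuous fun α => ‖⟪ket k, coherent α⟫_ℂ‖ ^ 2 :=
      ((continuous_const.inner continuous_coherent).norm.pow 2)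
    simp_rw [inner_ket_left] at this
    exact this.aestronglyMeasurable

theorem tendsto_inner_mixture {ι : Type*} {l : Filter ι} {μ : ι → ProbabilityMeasure ℂ}
    {μ₀ : ProbabilityMeasure ℂ} (h : Tendsto μ l (𝓝 μ₀)) (u v : Fock) :
    Tendsto (fun i => ⟪u, mixture (μ i : Measure ℂ) v⟫_ℂ) l
      (𝓝 ⟪u, mixture (μ₀ : Measure ℂ) v⟫_ℂ) := by
  simp_rw [inner_mixture]
  have hc : Continuous fun α => ⟪coherent α, v⟫_ℂ * ⟪u, coherent α⟫_ℂ :=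
    (continuous_coherent.inner continuous_const).mul (continuous_const.inner continuous_coherent)
  refine (ProbabilityMeasure.tendsto_iff_forall_integral_rclike_tendsto ℂ).1 h
    (BoundedContinuousFunction.ofNormedAddCommGroup _ hc (‖v‖ * ‖u‖) fun α => ?_)
  rw [norm_mul]
  gcongr
  · simpa [norm_coherent] using norm_inner_le_norm (𝕜 := ℂ) (coherent α) v
  · simpa [norm_coherent] using norm_inner_le_norm (𝕜 := ℂ) u (coherent α)

/-! ### Moments of the complex Gaussian law -/

theorem complexGaussian_zero : complexGaussian 0 = Measure.dirac 0 := by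
  rw [complexGaussian, zero_div, gaussianReal_zero_var, Measure.dirac_prod_dirac,
    Measure.map_dirac' (by fun_prop)]
  simp

/-- For `m ≠ 0` the law `CN(0, m)` has the density `(π m)⁻¹ exp (-|z|² / m)`. -/
theorem integral_complexGaussian {m : ℝ≥0} (hm : m ≠ 0) (f : ℂ → ℂ) :
    ∫ z, f z ∂complexGaussian m =
      ∫ z : ℂ, ((Real.pi * m)⁻¹ * Real.exp (-(m : ℝ)⁻¹ * ‖z‖ ^ 2)) • f z := by
  have hm2 : m / 2 ≠ 0 := by positivity
  have hmap : complexGaussian m = ((gaussianReal 0 (m / 2)).prod (gaussianReal 0 (m / 2))).map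
      Complex.measurableEquivRealProd.symm := by
    rw [complexGaussian]
    congr 1
    funext p
    exact (Complex.mk_eq_add_mul_I _ _).symm
  rw [hmap, Complex.measurableEquivRealProd.symm.measurableEmbedding.integral_map,
    gaussianReal_of_var_ne_zero _ hm2,
    prod_withDensity (measurable_gaussianPDF _ _) (measurable_gaussianPDF _ _),
    integral_withDensity_eq_integral_toReal_smul (by fun_prop)
      (ae_of_all _ fun _ => ENNReal.mul_lt_top gaussianPDF_lt_top gaussianPDF_lt_top),
    ← Measure.volume_eq_prod,
    ← Complex.volume_preserving_equiv_real_prod.symm.integral_comp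
      Complex.measurableEquivRealProd.symm.measurableEmbedding]
  congr 1
  funext p
  congr 1
  have hm' : (m : ℝ) ≠ 0 := by exact_mod_cast hm
  have hsq : ‖Complex.measurableEquivRealProd.symm p‖ ^ 2 = p.1 ^ 2 + p.2 ^ 2 := by
    rw [← Complex.normSq_eq_norm_sq, Complex.normSq_apply]
    change p.1 * p.1 + p.2 * p.2 = _
    ring
  rw [hsq, ENNReal.toReal_mul, toReal_gaussianPDF, toReal_gaussianPDF, gaussianPDFReal,
    gaussianPDFReal, mul_mul_mul_comm, ← Real.exp_add, ← mul_inv,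
    Real.mul_self_sqrt (by positivity)]
  push_cast
  congr 2
  · ring
  · field_simp
    ring

/-- Rotation by `π / (k - j)` multiplies the integrand by `-1` and preserves Lebesgue measure. This
needs no integrability. -/
theorem integral_conj_pow_mul_pow_mul_radial {j k : ℕ} (hjk : j ≠ k) (g : ℝ → ℂ) :
    ∫ z : ℂ, (starRingEnd ℂ z) ^ j * z ^ k * g ‖z‖ = 0 := by
  set θ : ℝ := Real.pi / ((k : ℝ) - j)
  have hkj : (k : ℝ) - j ≠ 0 := sub_ne_zero.2 (by exact_mod_cast hjk.symm)
  set I := ∫ z : ℂ, (starRingEnd ℂ z) ^ j * z ^ k * g ‖z‖ with hI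
  have hrot := (rotation (Circle.exp θ)).measurePreserving.integral_comp
    (rotation (Circle.exp θ)).toHomeomorph.measurableEmbedding
    (fun z : ℂ => (starRingEnd ℂ z) ^ j * z ^ k * g ‖z‖)
  have hphase : (starRingEnd ℂ (Circle.exp θ : ℂ)) ^ j * (Circle.exp θ : ℂ) ^ k = -1 := by
    rw [Circle.coe_exp, ← Complex.exp_conj, ← Complex.exp_nat_mul, ← Complex.exp_nat_mul,
      ← Complex.exp_add, ← Complex.exp_pi_mul_I]
    congr 1
    have h : (Real.pi : ℂ) = ((k : ℂ) - j) * θ := by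
      have : Real.pi = ((k : ℝ) - j) * θ := by simp only [θ]; field_simp
      exact_mod_cast congrArg (fun x : ℝ => (x : ℂ)) this
    rw [h]
    simp only [map_mul, Complex.conj_ofReal, Complex.conj_I]
    ring
  have hneg : ∀ z : ℂ, (starRingEnd ℂ (rotation (Circle.exp θ) z)) ^ j *
      (rotation (Circle.exp θ) z) ^ k * g ‖rotation (Circle.exp θ) z‖ =
      -((starRingEnd ℂ z) ^ j * z ^ k * g ‖z‖) := fun z => by
    rw [LinearIsometryEquiv.norm_map, rotation_apply, map_mul, mul_pow, mul_pow]
    linear_combination ((starRingEnd ℂ z) ^ j * z ^ k * g ‖z‖) * hphase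
  simp_rw [hneg] at hrot
  rw [integral_neg, ← hI] at hrot
  exact self_eq_neg.1 hrot.symm

theorem integral_norm_pow_mul_exp_neg_mul_norm_sq (k : ℕ) {b : ℝ} (hb : 0 < b) :
    ∫ z : ℂ, ‖z‖ ^ (2 * k) * Real.exp (-b * ‖z‖ ^ 2) =
      Real.pi * k.factorial / b ^ (k + 1) := by
  have h := Complex.integral_rpow_mul_exp_neg_mul_rpow (p := 2) (q := (2 * k : ℕ)) (b := b)
    (by norm_num) (by linarith [Nat.cast_nonneg (α := ℝ) (2 * k)]) hb
  have e : ((2 * k : ℕ) + 2 : ℝ) / 2 = ((k + 1 : ℕ) : ℝ) := by push_cast; ring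
  simp only [Real.rpow_natCast, Real.rpow_two] at h
  rw [h, neg_div, e, Real.rpow_neg hb.le, Real.rpow_natCast]
  push_cast
  rw [Real.Gamma_nat_eq_factorial]
  field_simp

theorem conj_coherentCoeff_mul (z : ℂ) (j k : ℕ) :
    starRingEnd ℂ (coherentCoeff z j) * coherentCoeff z k =
      ((Real.exp (-‖z‖ ^ 2) / (Real.sqrt j.factorial * Real.sqrt k.factorial) : ℝ) : ℂ) *
        ((starRingEnd ℂ z) ^ j * z ^ k) := by
  have h : Real.exp (-‖z‖ ^ 2) = Real.exp (-‖z‖ ^ 2 / 2) * Real.exp (-‖z‖ ^ 2 / 2) := by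
    rw [← Real.exp_add]; congr 1; ring
  rw [h, coherentCoeff, coherentCoeff]
  simp only [map_mul, map_div₀, map_pow, Complex.conj_ofReal]
  push_cast
  ring

theorem integral_conj_coherentCoeff_mul_of_ne (m : ℝ≥0) {j k : ℕ} (hjk : j ≠ k) :
    ∫ z, starRingEnd ℂ (coherentCoeff z j) * coherentCoeff z k ∂complexGaussian m = 0 := by
  rcases eq_or_ne m 0 with rfl | hm
  · rw [complexGaussian_zero, integral_dirac, conj_coherentCoeff_mul]
    rcases Nat.eq_zero_or_pos j with rfl | hj
    · simp [hjk.symm]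
    · simp [hj.ne']
  · rw [integral_complexGaussian hm, ← integral_conj_pow_mul_pow_mul_radial hjk fun r =>
      (((Real.pi * m)⁻¹ * Real.exp (-(m : ℝ)⁻¹ * r ^ 2) *
        (Real.exp (-r ^ 2) / (Real.sqrt j.factorial * Real.sqrt k.factorial)) : ℝ) : ℂ)]
    congr 1
    funext z
    rw [conj_coherentCoeff_mul, Complex.real_smul]
    push_cast
    ring

theorem integral_conj_coherentCoeff_mul_self (m : ℝ≥0) (k : ℕ) :
    ∫ z, starRingEnd ℂ (coherentCoeff z k) * coherentCoeff z k ∂complexGaussian m =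
      ((((m : ℝ) + 1)⁻¹ * (m / (m + 1)) ^ k : ℝ) : ℂ) := by
  rcases eq_or_ne m 0 with rfl | hm
  · rw [complexGaussian_zero, integral_dirac, conj_coherentCoeff_mul]
    rcases Nat.eq_zero_or_pos k with rfl | hk
    · simp
    · simp [hk.ne']
  · have hm' : 0 < (m : ℝ) := by exact_mod_cast pos_of_ne_zero hm
    have h : ∀ z : ℂ, ((Real.pi * m)⁻¹ * Real.exp (-(m : ℝ)⁻¹ * ‖z‖ ^ 2)) •
        (starRingEnd ℂ (coherentCoeff z k) * coherentCoeff z k) =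
        (((Real.pi * m)⁻¹ / k.factorial *
          (‖z‖ ^ (2 * k) * Real.exp (-((m : ℝ)⁻¹ + 1) * ‖z‖ ^ 2)) : ℝ) : ℂ) := fun z => by
      have he : Real.exp (-((m : ℝ)⁻¹ + 1) * ‖z‖ ^ 2) =
          Real.exp (-(m : ℝ)⁻¹ * ‖z‖ ^ 2) * Real.exp (-‖z‖ ^ 2) := by
        rw [← Real.exp_add]; congr 1; ring
      rw [conj_coherentCoeff_mul, Real.mul_self_sqrt (by positivity), he, ← mul_pow,
        Complex.conj_mul', ← pow_mul, Complex.real_smul]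
      push_cast
      ring
    simp_rw [integral_complexGaussian hm, h]
    rw [integral_complex_ofReal, integral_const_mul,
      integral_norm_pow_mul_exp_neg_mul_norm_sq k (by positivity)]
    congr 1
    have : (m : ℝ)⁻¹ + 1 = (m + 1) / m := by field_simp; ring
    rw [this, div_pow, div_pow]
    field_simp
    ring

/-! ### The EPR state -/

theorem eprCoeff_nonneg (ν : ℝ) (k : ℕ) : 0 ≤ eprCoeff ν k := by
  unfold eprCoeff; positivity

theorem eprCoeff_sq (m : ℝ≥0) (k : ℕ) :
    eprCoeff (2 * m + 1) k ^ 2 = ((m : ℝ) + 1)⁻¹ * (m / (m + 1)) ^ k := by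
  have hm : (0 : ℝ) ≤ m := m.2
  have h1 : 2 / (2 * (m : ℝ) + 1 + 1) = ((m : ℝ) + 1)⁻¹ := by field_simp; ring
  have h2 : (2 * (m : ℝ) + 1 - 1) / (2 * m + 1 + 1) = m / (m + 1) := by field_simp; ring
  rw [eprCoeff, h1, h2, mul_pow, ← pow_mul, mul_comm k 2, pow_mul, Real.sq_sqrt (by positivity),
    Real.sq_sqrt (by positivity)]

theorem hasSum_eprCoeff_sq (m : ℝ≥0) : HasSum (fun k => eprCoeff (2 * m + 1) k ^ 2) 1 := by
  have hm : (0 : ℝ) ≤ m := m.2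
  simp_rw [eprCoeff_sq]
  have hs := (hasSum_geometric_of_lt_one (by positivity : (0 : ℝ) ≤ m / (m + 1))
    ((div_lt_one (by positivity)).2 (lt_add_one _))).mul_left ((m : ℝ) + 1)⁻¹
  have h : 1 - (m : ℝ) / (m + 1) = ((m : ℝ) + 1)⁻¹ := by field_simp; ring
  rwa [h, inv_inv, inv_mul_cancel₀ (by positivity)] at hs

/-- The Gaussian mixture is diagonal in the number basis, with the squared amplitudes of the EPR
state with `ν = 2 m + 1` as eigenvalues. -/
theorem inner_ket_mixture_complexGaussian (m : ℝ≥0) [IsFiniteMeasure (complexGaussian m)]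
    (j k : ℕ) :
    ⟪ket j, mixture (complexGaussian m) (ket k)⟫_ℂ =
      ⟪ket j, ((eprCoeff (2 * m + 1) k ^ 2 : ℝ) : ℂ) • ket k⟫_ℂ := by
  rw [inner_ket_mixture_ket, inner_smul_right, inner_ket_ket]
  rcases eq_or_ne j k with rfl | hjk
  · rw [integral_conj_coherentCoeff_mul_self, eprCoeff_sq, if_pos rfl, mul_one]
  · rw [integral_conj_coherentCoeff_mul_of_ne m hjk.symm, if_neg hjk, mul_zero]

theorem summable_eprCoeff {ν : ℝ} (hν : 1 ≤ ν) : Summable (eprCoeff ν) := by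
  refine (summable_geometric_of_lt_one (Real.sqrt_nonneg _) ?_).mul_left _
  rw [Real.sqrt_lt' one_pos, one_pow, div_lt_one (by linarith)]
  linarith

theorem hasSum_inner_epr {ν : ℝ} (hν : 1 ≤ ν) (Φ : TwoMode) :
    HasSum (fun k => (eprCoeff ν k : ℂ) * ⟪Φ, tensorVec (ket k) (ket k)⟫_ℂ) ⟪Φ, epr ν⟫_ℂ := by
  have h := (summable_epr hν).hasSum.mapL (innerSL ℂ Φ)
  simp only [innerSL_apply_apply, inner_smul_right] at h
  exact h

theorem inner_tensorVec_ket_epr {ν : ℝ} (hν : 1 ≤ ν) (k : ℕ) :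
    ⟪tensorVec (ket k) (ket k), epr ν⟫_ℂ = eprCoeff ν k := by
  refine (hasSum_inner_epr hν _).unique ?_
  refine (hasSum_ite_eq k (eprCoeff ν k : ℂ)).congr_fun fun j => ?_
  rw [inner_tensorVec, inner_ket_ket]
  rcases eq_or_ne j k with rfl | hj
  · simp
  · simp [hj, hj.symm]

theorem norm_epr (m : ℝ≥0) : ‖epr (2 * m + 1)‖ = 1 := by
  have hν : (1 : ℝ) ≤ 2 * m + 1 := by linarith [m.2]
  have h := hasSum_inner_epr hν (epr (2 * m + 1))
  have hterm : ∀ k, (eprCoeff (2 * m + 1) k : ℂ) *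
      ⟪epr (2 * m + 1), tensorVec (ket k) (ket k)⟫_ℂ =
      ((eprCoeff (2 * m + 1) k ^ 2 : ℝ) : ℂ) := fun k => by
    rw [← inner_conj_symm, inner_tensorVec_ket_epr hν, Complex.conj_ofReal]
    push_cast
    ring
  simp_rw [hterm] at h
  have h1 := h.unique (Complex.hasSum_ofReal.2 (hasSum_eprCoeff_sq m))
  rw [inner_self_eq_norm_sq_to_K] at h1
  have h2 : ‖epr (2 * m + 1)‖ ^ 2 = 1 := Complex.ofReal_injective (by simpa using h1)
  exact (pow_eq_one_iff_of_nonneg (norm_nonneg _) two_ne_zero).1 h2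

/-! ### Norm convergence in Fock space from convergence of amplitudes -/

/-- Amplitudewise convergence improves to norm convergence when the squared amplitudes are
dominated by probability distributions `f n` that converge pointwise to a probability distribution
`g`, so that no mass escapes to infinity. The limit is assumed to be a multiple of `|k⟩`. -/
theorem tendsto_of_tendsto_apply_of_norm_sq_le {x : ℕ → Fock} {y : Fock} {f : ℕ → ℕ → ℝ}
    {g : ℕ → ℝ} {k : ℕ} (hx : ∀ j, Tendsto (fun n => x n j) atTop (𝓝 (y j)))
    (hy : ∀ j, j ≠ k → y j = 0) (hle : ∀ n j, ‖x n j‖ ^ 2 ≤ f n j)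
    (hf : ∀ n, HasSum (f n) 1) (hg : HasSum g 1)
    (hfg : ∀ j, Tendsto (fun n => f n j) atTop (𝓝 (g j))) :
    Tendsto x atTop (𝓝 y) := by
  rw [tendsto_iff_norm_sub_tendsto_zero]
  suffices hsq : Tendsto (fun n => ‖x n - y‖ ^ 2) atTop (𝓝 0) by
    simpa [Real.sqrt_sq (norm_nonneg _)] using hsq.sqrt
  refine tendsto_order.2 ⟨fun ε hε => .of_forall fun n => hε.trans_le (sq_nonneg _),
    fun ε hε => ?_⟩
  obtain ⟨N, hN, hkN⟩ : ∃ N, 1 - ε < ∑ j ∈ Finset.range N, g j ∧ k < N :=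
    ((hg.tendsto_sum_nat.eventually (lt_mem_nhds (by linarith : 1 - ε < 1))).and
      (eventually_gt_atTop k)).exists
  -- Beyond `N > k` the amplitudes of `y` vanish, and those of `x n` are bounded by the tail of `f n`.
  have hbound : ∀ n, ‖x n - y‖ ^ 2 ≤
      ∑ j ∈ Finset.range N, ‖x n j - y j‖ ^ 2 + (1 - ∑ j ∈ Finset.range N, f n j) := fun n => by
    have h1 := hasSum_norm_apply_sq (x n - y)
    rw [← h1.tsum_eq, ← (hf n).tsum_eq, ← h1.summable.sum_add_tsum_nat_add N,
      ← (hf n).summable.sum_add_tsum_nat_add N, add_sub_cancel_left]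
    refine add_le_add le_rfl (Summable.tsum_le_tsum (fun j => ?_)
      ((summable_nat_add_iff N).2 h1.summable) ((summable_nat_add_iff N).2 (hf n).summable))
    rw [lp.coeFn_sub, Pi.sub_apply, hy (j + N) (by omega), sub_zero]
    exact hle n _
  have hlim : Tendsto (fun n => ∑ j ∈ Finset.range N, ‖x n j - y j‖ ^ 2 +
      (1 - ∑ j ∈ Finset.range N, f n j)) atTop
      (𝓝 (∑ j ∈ Finset.range N, ‖y j - y j‖ ^ 2 + (1 - ∑ j ∈ Finset.range N, g j))) :=
    (tendsto_finsetSum _ fun j _ => ((hx j).sub_const _).norm.pow 2).add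
      (tendsto_const_nhds.sub (tendsto_finsetSum _ fun j _ => hfg j))
  have hlt : ∑ j ∈ Finset.range N, ‖y j - y j‖ ^ 2 + (1 - ∑ j ∈ Finset.range N, g j) < ε := by
    simp only [sub_self, norm_zero, ne_eq, OfNat.ofNat_ne_zero, not_false_eq_true, zero_pow,
      Finset.sum_const_zero, zero_add]
    linarith
  filter_upwards [hlim.eventually (gt_mem_nhds hlt)] with n hn
  exact (hbound n).trans_lt hn

/-! ### Convergence of the purifications -/

section Convergence

variable {μ : ℕ → ProbabilityMeasure ℂ} {μ₀ : ProbabilityMeasure ℂ} {m : ℝ≥0}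

theorem norm_opSqrt_mixture_ket_le_one (μ : Measure ℂ) [IsProbabilityMeasure μ] (k : ℕ) :
    ‖opSqrt (mixture μ) (ket k)‖ ≤ 1 :=
  (sq_le_one_iff₀ (norm_nonneg _)).1
    (le_hasSum (hasSum_norm_opSqrt_mixture_sq μ) k fun _ _ => sq_nonneg _)

/-- Cauchy–Schwarz for the positive form of the mixture, whose diagonal elements are at most one. -/
theorem norm_inner_ket_mixture_ket_sq_le (μ : Measure ℂ) [IsProbabilityMeasure μ] (j k : ℕ) :
    ‖⟪ket j, mixture μ (ket k)⟫_ℂ‖ ^ 2 ≤ ‖opSqrt (mixture μ) (ket j)‖ ^ 2 := by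
  rw [← inner_opSqrt_opSqrt (mixture_nonneg μ)]
  gcongr
  exact (norm_inner_le_norm _ _).trans
    (mul_le_of_le_one_right (norm_nonneg _) (norm_opSqrt_mixture_ket_le_one μ k))

theorem norm_opSqrt_mixture_ket_sq (μ : Measure ℂ) [IsFiniteMeasure μ] (k : ℕ) :
    ‖opSqrt (mixture μ) (ket k)‖ ^ 2 = (⟪ket k, mixture μ (ket k)⟫_ℂ).re := by
  rw [← inner_opSqrt_opSqrt (mixture_nonneg μ), ← RCLike.re_to_complex, inner_self_eq_norm_sq]

theorem tendsto_mixture_ket (h : Tendsto μ atTop (𝓝 μ₀))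
    (hμ₀ : (μ₀ : Measure ℂ) = complexGaussian m) (k : ℕ) :
    Tendsto (fun n => mixture (μ n : Measure ℂ) (ket k)) atTop
      (𝓝 (((eprCoeff (2 * m + 1) k ^ 2 : ℝ) : ℂ) • ket k)) := by
  have : IsProbabilityMeasure (complexGaussian m) := hμ₀ ▸ μ₀.2
  have hentry : ∀ i j, Tendsto (fun n => ⟪ket i, mixture (μ n : Measure ℂ) (ket j)⟫_ℂ) atTop
      (𝓝 ⟪ket i, ((eprCoeff (2 * m + 1) j ^ 2 : ℝ) : ℂ) • ket j⟫_ℂ) := fun i j => by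
    rw [← inner_ket_mixture_complexGaussian, ← hμ₀]
    exact tendsto_inner_mixture h _ _
  refine tendsto_of_tendsto_apply_of_norm_sq_le (k := k) (fun j => ?_) (fun j hj => ?_)
    (fun n j => ?_) (fun n => hasSum_norm_opSqrt_mixture_sq (μ n : Measure ℂ))
    (hasSum_eprCoeff_sq m) (fun j => ?_)
  · simpa only [inner_ket_left] using hentry j k
  · rw [← inner_ket_left, inner_smul_right, inner_ket_ket, if_neg hj, mul_zero]
  · rw [← inner_ket_left]
    exact norm_inner_ket_mixture_ket_sq_le _ j k
  · simp_rw [norm_opSqrt_mixture_ket_sq]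
    have hre := (Complex.continuous_re.tendsto _).comp (hentry j j)
    rwa [inner_smul_right, inner_ket_ket, if_pos rfl, mul_one, Complex.ofReal_re] at hre

/-- The factor `eprCoeff` makes the statement true also where it vanishes, in which case
`norm_opSqrt_sub_smul_le` says nothing about `ρₙ^{1/2}|k⟩`. -/
theorem tendsto_eprCoeff_mul_inner_opSqrt (h : Tendsto μ atTop (𝓝 μ₀))
    (hμ₀ : (μ₀ : Measure ℂ) = complexGaussian m) (k : ℕ) :
    Tendsto (fun n => (eprCoeff (2 * m + 1) k : ℂ) *
        ⟪opSqrt (mixture (μ n : Measure ℂ)) (ket k), ket k⟫_ℂ) atTop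
      (𝓝 ((eprCoeff (2 * m + 1) k ^ 2 : ℝ) : ℂ)) := by
  set s := eprCoeff (2 * m + 1) k with hs
  have hs0 : 0 ≤ s := eprCoeff_nonneg _ k
  have hlim : Tendsto (fun n => (s : ℂ) • (opSqrt (mixture (μ n : Measure ℂ)) (ket k) -
      (s : ℂ) • ket k)) atTop (𝓝 0) := by
    refine squeeze_zero_norm (fun n => ?_)
      (tendsto_iff_norm_sub_tendsto_zero.1 (tendsto_mixture_ket h hμ₀ k))
    rw [norm_smul, Complex.norm_real, Real.norm_of_nonneg hs0]
    exact norm_opSqrt_sub_smul_le (mixture_nonneg _) hs0 _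
  have h1 := (hlim.inner (tendsto_const_nhds (x := ket k)) (𝕜 := ℂ)).add_const ((s : ℂ) ^ 2)
  simp only [inner_zero_left, zero_add, inner_smul_left, inner_sub_left, inner_ket_ket,
    Complex.conj_ofReal, if_pos] at h1
  push_cast
  refine h1.congr fun n => ?_
  ring

theorem tendsto_inner_purification_epr (h : Tendsto μ atTop (𝓝 μ₀))
    (hμ₀ : (μ₀ : Measure ℂ) = complexGaussian m) :
    Tendsto (fun n => ⟪purification (mixture (μ n : Measure ℂ)), epr (2 * m + 1)⟫_ℂ) atTop
      (𝓝 1) := by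
  have hm : (0 : ℝ) ≤ m := m.2
  have hν : (1 : ℝ) ≤ 2 * m + 1 := by linarith
  have hterm : ∀ n k, ⟪purification (mixture (μ n : Measure ℂ)), tensorVec (ket k) (ket k)⟫_ℂ =
      ⟪opSqrt (mixture (μ n : Measure ℂ)) (ket k), ket k⟫_ℂ := fun n k => by
    rw [← inner_conj_symm,
      inner_tensorVec_ket_purification (hasSum_norm_opSqrt_mixture_sq _), inner_conj_symm]
  have hsum := fun n => (hasSum_inner_epr hν (purification (mixture (μ n : Measure ℂ)))).tsum_eq
  simp_rw [hterm] at hsum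
  simp_rw [← hsum]
  have hlim := tendsto_tsum_of_dominated_convergence (summable_eprCoeff hν)
    (tendsto_eprCoeff_mul_inner_opSqrt h hμ₀) (.of_forall fun n k => ?_)
  · rwa [(Complex.hasSum_ofReal.2 (hasSum_eprCoeff_sq m)).tsum_eq, Complex.ofReal_one] at hlim
  · rw [norm_mul, Complex.norm_real, Real.norm_of_nonneg (eprCoeff_nonneg _ k)]
    refine mul_le_of_le_one_right (eprCoeff_nonneg _ k) ((norm_inner_le_norm _ _).trans ?_)
    rw [norm_ket, mul_one]
    exact norm_opSqrt_mixture_ket_le_one _ k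

end Convergence

theorem proposition3 {Ω : ℕ → Type*} {Ω' : Type*}
    [∀ n, MeasurableSpace (Ω n)] [MeasurableSpace Ω']
    (P : (n : ℕ) → Measure (Ω n)) [∀ n, IsProbabilityMeasure (P n)]
    (P' : Measure Ω') [IsProbabilityMeasure P']
    (X : (n : ℕ) → Ω n → ℂ) (XG : Ω' → ℂ) (m : ℝ≥0)
    (hG : HasLaw XG (complexGaussian m) P')
    (hX : TendstoInDistribution X atTop XG P P') :
    -- each vector is given by a convergent series and purifies the mixture of coherent states
    (∀ n, Summable (purificationTerm (mixture ((P n).map (X n)))) ∧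
      IsPurification (purification (mixture ((P n).map (X n)))) (mixture ((P n).map (X n)))) ∧
    -- weak convergence to the EPR state
    (∀ ψ γ : TwoMode,
      Tendsto (fun n => ⟪ψ, proj (purification (mixture ((P n).map (X n)))) γ⟫_ℂ) atTop
        (𝓝 ⟪ψ, proj (epr (2 * (m : ℝ) + 1)) γ⟫_ℂ)) ∧
    -- convergence to the EPR state in trace norm
    Tendsto (fun n => traceNorm
        (proj (purification (mixture ((P n).map (X n)))) - proj (epr (2 * (m : ℝ) + 1)))) atTop
      (𝓝 0) := by
  have hprob : ∀ n, IsProbabilityMeasure ((P n).map (X n)) := fun n =>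
    Measure.isProbabilityMeasure_map (hX.forall_aemeasurable n)
  have hsum := fun n => hasSum_norm_opSqrt_mixture_sq ((P n).map (X n))
  have hinner : Tendsto (fun n => ⟪purification (mixture ((P n).map (X n))),
      epr (2 * (m : ℝ) + 1)⟫_ℂ) atTop (𝓝 1) :=
    tendsto_inner_purification_epr
      (μ := fun n => ⟨(P n).map (X n), hprob n⟩)
      (μ₀ := ⟨P'.map XG, Measure.isProbabilityMeasure_map hX.aemeasurable_limit⟩)
      hX.tendsto hG.map_eq
  have hnorm := fun n => norm_purification (hsum n)
  refine ⟨fun n => ⟨summable_purificationTerm (hsum n),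
    isPurification_purification (mixture_nonneg _) (hsum n)⟩, fun ψ γ => ?_, ?_⟩
  · have hΦ := tendsto_of_tendsto_inner_of_norm_eq_one hnorm (norm_epr m) hinner
    have hc : Continuous fun Φ : TwoMode => ⟪ψ, proj Φ γ⟫_ℂ := by
      simp_rw [inner_proj]
      fun_prop
    exact (hc.tendsto _).comp hΦ
  · have hlim : Tendsto (fun n => ENNReal.ofReal (2 * Real.sqrt (1 -
        ‖⟪purification (mixture ((P n).map (X n))), epr (2 * (m : ℝ) + 1)⟫_ℂ‖ ^ 2))) atTop
        (𝓝 0) := by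
      convert ENNReal.tendsto_ofReal (((hinner.norm.pow 2).const_sub 1).sqrt.const_mul 2)
      simp
    exact tendsto_of_tendsto_of_tendsto_of_le_of_le tendsto_const_nhds hlim
      (fun _ => zero_le) fun n => traceNorm_proj_sub_proj_le (hnorm n) (norm_epr m)
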